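/- For integers $k,m\ge 1$ define, with $\log$ the natural logarithm and $0\log 0=0$, \[h_{k,m}(t)=-kt\log t-(1-kt)\log(1-kt)+(1-kt)\log m,\] \[\begin{aligned}g_{k,m}(x,y)={}&-(1-kx)(1-ky)\log\big((1-kx)(1-ky)\big)\\&-\Big(x+y+\big(\tfrac{k(k-1)}2-1\big)xy\Big)\log\Big(x+y+\big(\tfrac{k(k-1)}2-1\big)xy\Big)\\&-\sum_{j=1}^{k-1}\big(x+y-(2k-j+1)xy\big)\log\big(x+y-(2k-j+1)xy\big)+(1-kx)(1-ky)\log m,\end{aligned}\] and, for a probability measure $\mu$ on $[0,1]$, \[F_{k,m}(\mu)=\mathbb{E}_{(x,y)\sim\mu\times\mu}\Big[g_{k,m}\Big(\frac xk,\frac yk\Big)\Big]-\mathbb{E}_{x\sim\mu}\Big[h_{k,m}\Big(\frac xk\Big)\Big].\] Let $k\ge 5$ and $1\le m\le\sqrt k$ be integers, and let $0<\phi<\frac12$ and $x\in[\phi,1]$ be real numbers. Then $\big(1-\frac{\phi}{x}\big)\delta_0+\frac{\phi}{x}\delta_x$ is a probability measure on $[0,1]$ with expectation $\phi$, and \[F_{k,m}\Big(\Big(1-\frac{\phi}{x}\Big)\delta_0+\frac{\phi}{x}\delta_x\Big)>0.\]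 -/

import Mathlib

open MeasureTheory

namespace Frankl

/-- The one-variable entropy function `h_{k,m}`. With `Real.log 0 = 0` the usual convention
`0 log 0 = 0` holds. -/
noncomputable def h (k m : ℕ) (t : ℝ) : ℝ :=
  -(k * t * Real.log t) - (1 - k * t) * Real.log (1 - k * t) + (1 - k * t) * Real.log m

/-- The two-variable entropy function `g_{k,m}`. -/
noncomputable def g (k m : ℕ) (x y : ℝ) : ℝ :=
  -((1 - k * x) * (1 - k * y) * Real.log ((1 - k * x) * (1 - k * y)))
    - (x + y + ((k : ℝ) * (k - 1) / 2 - 1) * (x * y))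
        * Real.log (x + y + ((k : ℝ) * (k - 1) / 2 - 1) * (x * y))
    - ∑ j ∈ Finset.Icc 1 (k - 1),
        (x + y - (2 * (k : ℝ) - j + 1) * (x * y))
          * Real.log (x + y - (2 * (k : ℝ) - j + 1) * (x * y))
    + (1 - k * x) * (1 - k * y) * Real.log m

/-- `M φ` is the set of probability measures on `[0,1]`, regarded as measures on `ℝ` that are
concentrated on `[0,1]`, with expectation `φ`. -/
def M (φ : ℝ) : Set (Measure ℝ) :=
  {μ | IsProbabilityMeasure μ ∧ μ (Set.Icc 0 1)ᶜ = 0 ∧ ∫ x, x ∂μ = φ}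

/-- The functional `F_{k,m}`: the expectation of `g_{k,m}(x/k, y/k)` over independent `x, y`
with law `μ`, minus the expectation of `h_{k,m}(x/k)`. It is meant for `μ` in some `M φ`. -/
noncomputable def F (k m : ℕ) (μ : Measure ℝ) : ℝ :=
  (∫ p : ℝ × ℝ, g k m (p.1 / k) (p.2 / k) ∂(μ.prod μ)) - ∫ x, h k m (x / k) ∂μ

/-- The type II measure `(1 - φ/x) δ_0 + (φ/x) δ_x`. -/
noncomputable def typeII (φ x : ℝ) : Measure ℝ :=
  ENNReal.ofReal (1 - φ / x) • Measure.dirac 0 + ENNReal.ofReal (φ / x) • Measure.dirac x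

end Frankl

namespace Frankl

/-! Put `w = φ / x`. Since `g` with one argument zero reduces to `h`, and `h` at `0` is `log m`, `F`
equals `w` times an expression affine in `w` (`F_typeII`). Here `0 < w ≤ 1` and `w < 1 / (2 * x)`,
so positivity of that expression follows from its values at the ends: at `w = 0`
(`h_div_sub_log_pos`), and at `w = 1` when `x < 1 / 2` (`full_weight_pos`) or at `w = 1 / (2 * x)`
when `x ≥ 1 / 2` (`half_weight_nonneg`).

For the nonzero ends, tangents to the logarithm bound the entropy in `g` below (`g_diag_ge`): the
outcomes beyond the head form an arithmetic progression, so only their sum and sum of squares enter.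
Replacing `log m` by `log k / 2 - e` and bounding the remaining logarithms leaves polynomials in `x`
and `s = 1 / k`. After a square is dropped for small `x`, these are concave quadratics in `x`, so
endpoint checks suffice. -/

/-! ### Polynomial inequalities -/

/-- With `s = 1/k`: the mass of the first outcome, divided by `x`. -/
noncomputable def headMass (s x : ℝ) : ℝ := 2 * (1 - x) * s + x * (1 / 2 + 3 / 2 * s - s ^ 2)

/-- With `s = 1/k`: the total mass of the other outcomes, divided by `x`. -/
noncomputable def tailMass (s x : ℝ) : ℝ := 2 - x - headMass s x

/-- With `s = 1/k`: the sum of the squares of the masses of the other outcomes,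
divided by `s * x ^ 2`. -/
noncomputable def tailSq (s x : ℝ) : ℝ :=
  (1 - s) * (4 * (1 - x) ^ 2 + 2 * (1 - x) * x * (1 - 2 * s)
    + x ^ 2 * (1 - 2 * s) * (2 - 3 * s) / 6)

/-- The coefficient of `-s * log k` in the lower bounds. -/
noncomputable def logCoeff (s x : ℝ) : ℝ := 2 - (1 / 2 + s) * x

/-- A concave function lies above its chord. -/
theorem quadratic_nonneg {a b c u v x : ℝ} (ha : a ≤ 0) (hu : u ≤ x) (hv : x ≤ v)
    (fu : 0 ≤ a * u ^ 2 + b * u + c) (fv : 0 ≤ a * v ^ 2 + b * v + c) :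
    0 ≤ a * x ^ 2 + b * x + c := by
  rcases hu.eq_or_lt with rfl | hu'
  · exact fu
  have huv : 0 < v - u := by linarith
  have h1 := mul_nonneg (sub_nonneg.2 hv) fu
  have h2 := mul_nonneg (sub_nonneg.2 hu) fv
  have h3 : 0 ≤ -a * ((x - u) * (v - x) * (v - u)) :=
    mul_nonneg (by linarith) (mul_nonneg (mul_nonneg (by linarith) (by linarith)) huv.le)
  refine nonneg_of_mul_nonneg_right ?_ huv
  linear_combination h1 + h2 + h3

theorem poly_nonneg_mid {s x e : ℝ} (hs0 : 0 ≤ s) (hs : s ≤ 1 / 5) (he0 : 0 ≤ e)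
    (he : 3 * s - 1 / 2 ≤ e) (hx1 : 1 / 2 ≤ x) (hx2 : x ≤ 3 / 4) :
    0 ≤ (1.693 - 2 * x) * x + (headMass s x * 1.693 - 2 * headMass s x ^ 2)
      + (tailMass s x * 0.83 - 27 / 32 * tailSq s x)
      - logCoeff s x * (0.792 * s + 1 / 6) + e * x := by
  have key := quadratic_nonneg (x := x) (u := 1 / 2) (v := 3 / 4)
    (a := -2 - 2 * (1 / 2 - s / 2 - s ^ 2) ^ 2
      - 27 / 32 * ((1 - s) * (4 - 2 * (1 - 2 * s) + (1 - 2 * s) * (2 - 3 * s) / 6)))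
    (b := 1.693 + (1 / 2 - s / 2 - s ^ 2) * 1.693 - 8 * s * (1 / 2 - s / 2 - s ^ 2)
      - (3 / 2 - s / 2 - s ^ 2) * 0.83 - 27 / 32 * ((1 - s) * (2 * (1 - 2 * s) - 8))
      + (1 / 2 + s) * (0.792 * s + 1 / 6) + e)
    (c := 2 * s * 1.693 - 8 * s ^ 2 + (2 - 2 * s) * 0.83 - 27 / 32 * ((1 - s) * 4)
      - 2 * (0.792 * s + 1 / 6))
    (by nlinarith [mul_nonneg hs0 hs0, sq_nonneg (1 / 2 - s / 2 - s ^ 2),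
          mul_nonneg (sub_nonneg.2 hs) hs0, mul_nonneg (mul_nonneg hs0 hs0) hs0]) hx1 hx2
    (by
      -- The lower bound `max 0 (3 * s - 1 / 2)` on `e` changes branch at `s = 1 / 6`.
      rcases le_total s (1 / 6) with h | h
      · nlinarith [mul_nonneg hs0 (sub_nonneg.2 h), mul_nonneg (mul_nonneg hs0 hs0) (sub_nonneg.2 h),
          mul_nonneg (mul_nonneg hs0 hs0) (mul_nonneg hs0 hs0), mul_nonneg (mul_nonneg hs0 hs0) hs0]
      · nlinarith [mul_nonneg (sub_nonneg.2 hs) (sub_nonneg.2 h), mul_nonneg hs0 (sub_nonneg.2 hs),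
          mul_nonneg (mul_nonneg hs0 hs0) (sub_nonneg.2 hs)])
    (by
      nlinarith [mul_nonneg hs0 (sub_nonneg.2 hs), mul_nonneg (mul_nonneg hs0 hs0) (sub_nonneg.2 hs),
          mul_nonneg (mul_nonneg hs0 hs0) (mul_nonneg hs0 hs0), mul_nonneg (mul_nonneg hs0 hs0) hs0])
  unfold tailMass tailSq logCoeff headMass
  linear_combination key

theorem poly_nonneg_high {s x e : ℝ} (hs0 : 0 ≤ s) (hs : s ≤ 1 / 5) (he0 : 0 ≤ e)
    (he : 3 * s - 1 / 2 ≤ e) (hx1 : 3 / 4 ≤ x) (hx2 : x ≤ 1) :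
    0 ≤ (1 - x) * x + (headMass s x * 1.2876 - 4 / 3 * headMass s x ^ 2)
      + (tailMass s x * 1.693 - 2 * tailSq s x)
      - logCoeff s x * (0.792 * s + 1 / 6) + e * x := by
  have key := quadratic_nonneg (x := x) (u := 3 / 4) (v := 1)
    (a := -1 - 4 / 3 * (1 / 2 - s / 2 - s ^ 2) ^ 2
      - 2 * ((1 - s) * (4 - 2 * (1 - 2 * s) + (1 - 2 * s) * (2 - 3 * s) / 6)))
    (b := 1 + (1 / 2 - s / 2 - s ^ 2) * 1.2876 - 4 / 3 * (4 * s * (1 / 2 - s / 2 - s ^ 2))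
      - (3 / 2 - s / 2 - s ^ 2) * 1.693 - 2 * ((1 - s) * (2 * (1 - 2 * s) - 8))
      + (1 / 2 + s) * (0.792 * s + 1 / 6) + e)
    (c := 2 * s * 1.2876 - 4 / 3 * (4 * s ^ 2) + (2 - 2 * s) * 1.693 - 2 * ((1 - s) * 4)
      - 2 * (0.792 * s + 1 / 6))
    (by nlinarith [mul_nonneg hs0 hs0, sq_nonneg (1 / 2 - s / 2 - s ^ 2),
          mul_nonneg (sub_nonneg.2 hs) hs0, mul_nonneg (mul_nonneg hs0 hs0) hs0]) hx1 hx2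
    (by
      nlinarith [mul_nonneg hs0 (sub_nonneg.2 hs), mul_nonneg (mul_nonneg hs0 hs0) (sub_nonneg.2 hs),
          mul_nonneg (mul_nonneg hs0 hs0) (mul_nonneg hs0 hs0), mul_nonneg (mul_nonneg hs0 hs0) hs0])
    (by
      rcases le_total s (1 / 6) with h | h
      · nlinarith [mul_nonneg hs0 (sub_nonneg.2 h), mul_nonneg (mul_nonneg hs0 hs0) (sub_nonneg.2 h),
          mul_nonneg (mul_nonneg hs0 hs0) (mul_nonneg hs0 hs0), mul_nonneg (mul_nonneg hs0 hs0) hs0]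
      · nlinarith [mul_nonneg (sub_nonneg.2 hs) (sub_nonneg.2 h), mul_nonneg hs0 (sub_nonneg.2 hs),
          mul_nonneg (mul_nonneg hs0 hs0) (sub_nonneg.2 hs)])
  unfold tailMass tailSq logCoeff headMass
  linear_combination key

theorem poly_nonneg_low {s x e : ℝ} (hs0 : 0 ≤ s) (hs : s ≤ 1 / 5) (he0 : 0 ≤ e)
    (he : 3 * s - 1 / 2 ≤ e) (hx1 : 0 ≤ x) (hx2 : x ≤ 1 / 2) :
    0 ≤ (1 - 2 * x) * (1 - x) + (1.693 - 2 * x) * (1 - x)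
      + (headMass s x * 1.693 - 2 * headMass s x ^ 2)
      + (tailMass s x * 0.83 - 27 / 32 * tailSq s x)
      - logCoeff s x * (0.792 * s + 1 / 6) + (1 / 2 - x) * 1.5 + e * (1 - x) := by
  have key := quadratic_nonneg (x := x) (u := 0) (v := 1 / 2)
    (a := - 2 * (1 / 2 - s / 2 - s ^ 2) ^ 2
      - 27 / 32 * ((1 - s) * (4 - 2 * (1 - 2 * s) + (1 - 2 * s) * (2 - 3 * s) / 6)))
    (b := -2 - 0.693 + (1 / 2 - s / 2 - s ^ 2) * 1.693 - 8 * s * (1 / 2 - s / 2 - s ^ 2)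
      - (3 / 2 - s / 2 - s ^ 2) * 0.83 - 27 / 32 * ((1 - s) * (2 * (1 - 2 * s) - 8))
      + (1 / 2 + s) * (0.792 * s + 1 / 6) - 1.5 - e)
    (c := 1.693 + 2 * s * 1.693 - 8 * s ^ 2 + (2 - 2 * s) * 0.83 - 27 / 32 * ((1 - s) * 4)
      - 2 * (0.792 * s + 1 / 6) + 0.75 + e)
    (by nlinarith [mul_nonneg hs0 hs0, sq_nonneg (1 / 2 - s / 2 - s ^ 2),
          mul_nonneg (sub_nonneg.2 hs) hs0, mul_nonneg (mul_nonneg hs0 hs0) hs0]) hx1 hx2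
    (by
      nlinarith [mul_nonneg hs0 (sub_nonneg.2 hs)])
    (by
      rcases le_total s (1 / 6) with h | h
      · nlinarith [mul_nonneg hs0 (sub_nonneg.2 h), mul_nonneg (mul_nonneg hs0 hs0) (sub_nonneg.2 h),
          mul_nonneg (mul_nonneg hs0 hs0) (mul_nonneg hs0 hs0), mul_nonneg (mul_nonneg hs0 hs0) hs0]
      · nlinarith [mul_nonneg (sub_nonneg.2 hs) (sub_nonneg.2 h), mul_nonneg hs0 (sub_nonneg.2 hs),
          mul_nonneg (mul_nonneg hs0 hs0) (sub_nonneg.2 hs)])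
  unfold tailMass tailSq logCoeff headMass
  -- The target exceeds the concave quadratic of `key` by exactly `(1 - 2 * x) ^ 2`.
  nlinarith [sq_nonneg (1 - 2 * x)]

/-! ### Two-point measures -/

theorem integral_two_point {α : Type*} [MeasurableSpace α] [MeasurableSingletonClass α]
    {c d : ℝ} (hc : 0 ≤ c) (hd : 0 ≤ d) (a b : α) (f : α → ℝ) :
    ∫ p, f p ∂(ENNReal.ofReal c • Measure.dirac a + ENNReal.ofReal d • Measure.dirac b)
      = c * f a + d * f b := by
  have hi (a : α) (r : ℝ) : Integrable f (ENNReal.ofReal r • Measure.dirac a) :=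
    (integrable_dirac (by simp)).smul_measure ENNReal.ofReal_ne_top
  rw [integral_add_measure (hi _ _) (hi _ _), integral_smul_measure, integral_smul_measure,
    integral_dirac, integral_dirac, ENNReal.toReal_ofReal hc, ENNReal.toReal_ofReal hd,
    smul_eq_mul, smul_eq_mul]

theorem integral_prod_two_point {α : Type*} [MeasurableSpace α] [MeasurableSingletonClass α]
    {c d : ℝ} (hc : 0 ≤ c) (hd : 0 ≤ d) (a b : α) (f : α × α → ℝ) :
    ∫ p, f p ∂((ENNReal.ofReal c • Measure.dirac a + ENNReal.ofReal d • Measure.dirac b).prod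
        (ENNReal.ofReal c • Measure.dirac a + ENNReal.ofReal d • Measure.dirac b))
      = c * (c * f (a, a) + d * f (a, b)) + d * (c * f (b, a) + d * f (b, b)) := by
  have hi (p : α × α) (r t : ℝ) :
      Integrable f (ENNReal.ofReal r • ENNReal.ofReal t • Measure.dirac p) :=
    ((integrable_dirac (by simp)).smul_measure ENNReal.ofReal_ne_top).smul_measure
      ENNReal.ofReal_ne_top
  have hp (r t : ℝ) (a b : α) :
      (ENNReal.ofReal r • Measure.dirac a).prod (ENNReal.ofReal t • Measure.dirac b)
        = ENNReal.ofReal r • ENNReal.ofReal t • Measure.dirac (a, b) := by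
    rw [Measure.prod_smul_left, Measure.prod_smul_right, Measure.dirac_prod_dirac]
  rw [Measure.add_prod, Measure.prod_add, Measure.prod_add, hp, hp, hp, hp,
    integral_add_measure ((hi _ _ _).add_measure (hi _ _ _))
      ((hi _ _ _).add_measure (hi _ _ _)),
    integral_add_measure (hi _ _ _) (hi _ _ _), integral_add_measure (hi _ _ _) (hi _ _ _)]
  simp only [integral_smul_measure, integral_dirac, ENNReal.toReal_ofReal hc,
    ENNReal.toReal_ofReal hd, smul_eq_mul]
  ring

theorem typeII_mem_M {φ x : ℝ} (hφ0 : 0 < φ) (hx : x ∈ Set.Icc φ 1) : typeII φ x ∈ M φ := by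
  have hx0 : 0 < x := hφ0.trans_le hx.1
  have hw0 : 0 ≤ φ / x := by positivity
  have hw1 : 0 ≤ 1 - φ / x := sub_nonneg.2 ((div_le_one hx0).2 hx.1)
  refine ⟨⟨?_⟩, ?_, ?_⟩
  · simp only [typeII, Measure.add_apply, Measure.smul_apply, measure_univ, smul_eq_mul, mul_one]
    rw [← ENNReal.ofReal_add hw1 hw0]
    simp
  · simp [typeII, hx0.le, hx.2]
  · rw [typeII, integral_two_point hw1 hw0]
    field_simp
    ring

theorem h_zero (k m : ℕ) : h k m 0 = Real.log m := by simp [h]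

/-- The head outcome and the `k - 1` others all become `t`, giving the term `k * t * log t` of `h`.
-/
theorem g_zero_left {k : ℕ} (hk : 1 ≤ k) (m : ℕ) (t : ℝ) : g k m 0 t = h k m t := by
  simp only [g, h, mul_zero, zero_mul, sub_zero, zero_add, add_zero, one_mul, Finset.sum_const,
    Nat.card_Icc, Nat.add_sub_cancel, nsmul_eq_mul]
  push_cast [Nat.cast_sub hk]
  ring

theorem g_zero_right {k : ℕ} (hk : 1 ≤ k) (m : ℕ) (t : ℝ) : g k m t 0 = h k m t := by
  simp only [g, h, mul_zero, sub_zero, add_zero, mul_one, Finset.sum_const,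
    Nat.card_Icc, Nat.add_sub_cancel, nsmul_eq_mul]
  push_cast [Nat.cast_sub hk]
  ring

theorem F_typeII {k : ℕ} (hk : 1 ≤ k) (m : ℕ) {φ x : ℝ} (hφ0 : 0 < φ) (hx : x ∈ Set.Icc φ 1) :
    F k m (typeII φ x) = φ / x * ((h k m (x / k) - Real.log m)
      + φ / x * (g k m (x / k) (x / k) - 2 * h k m (x / k) + Real.log m)) := by
  have hx0 : 0 < x := hφ0.trans_le hx.1
  have hw0 : 0 ≤ φ / x := by positivity
  have hw1 : 0 ≤ 1 - φ / x := sub_nonneg.2 ((div_le_one hx0).2 hx.1)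
  rw [F, typeII, integral_two_point hw1 hw0, integral_prod_two_point hw1 hw0]
  simp only [zero_div, g_zero_left hk, g_zero_right hk, h_zero]
  ring

/-! ### Entropy bounds -/

theorem log_le_tangent {p r : ℝ} (hp : 0 < p) (hr : 0 < r) :
    Real.log p ≤ Real.log r + p / r - 1 := by
  have := Real.log_le_sub_one_of_pos (div_pos hp hr)
  rw [Real.log_div hp.ne' hr.ne'] at this
  linarith

/-- The tangent bound at `r`, multiplied by `-p`; the value at `p = 0` uses `0 log 0 = 0`. -/
theorem neg_mul_log_ge {p r : ℝ} (hp : 0 ≤ p) (hr : 0 < r) :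
    p * (1 - Real.log r) - p ^ 2 / r ≤ -(p * Real.log p) := by
  rcases hp.eq_or_lt with rfl | hp
  · simp
  · have := mul_le_mul_of_nonneg_left (log_le_tangent hp hr) hp.le
    rw [sq, mul_div_assoc]
    linarith

theorem sum_affine (n : ℕ) (c d : ℝ) :
    ∑ j ∈ Finset.Icc 1 n, (c + ((j : ℝ) - 1) * d) = n * c + n * (n - 1) / 2 * d := by
  induction n with
  | zero => simp
  | succ n ih => rw [Finset.sum_Icc_succ_top (by omega), ih]; push_cast; ring

theorem sum_affine_sq (n : ℕ) (c d : ℝ) :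
    ∑ j ∈ Finset.Icc 1 n, (c + ((j : ℝ) - 1) * d) ^ 2
      = n * c ^ 2 + n * (n - 1) * (c * d) + n * (n - 1) * (2 * n - 1) / 6 * d ^ 2 := by
  induction n with
  | zero => simp
  | succ n ih => rw [Finset.sum_Icc_succ_top (by omega), ih]; push_cast; ring

/-- Lower bound for the entropy of the outcomes of `g` on the diagonal, from tangents to the
logarithm at `x * t` and at `x / (k * r)`. -/
theorem g_diag_ge {k : ℕ} (hk : 2 ≤ k) (m : ℕ) {x t r : ℝ} (hx0 : 0 < x) (hx1 : x ≤ 1)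
    (ht : 0 < t) (hr : 0 < r) :
    -(2 * (1 - x) ^ 2 * Real.log (1 - x)) + (1 - x) ^ 2 * Real.log m
      + x * (headMass (1 / k) x * (1 - Real.log x - Real.log t) - headMass (1 / k) x ^ 2 / t
        + tailMass (1 / k) x * (1 - Real.log x + Real.log k + Real.log r)
        - tailSq (1 / k) x * r) ≤ g k m (x / k) (x / k) := by
  have hk0 : (0 : ℝ) < k := by exact_mod_cast (by omega : 0 < k)
  have hk2 : (2 : ℝ) ≤ k := by exact_mod_cast hk
  have hs : (1 : ℝ) / k ≤ 1 / 2 := one_div_le_one_div_of_le (by norm_num) hk2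
  have hs0 : (0 : ℝ) < 1 / k := by positivity
  have hA : x / k + x / k + ((k : ℝ) * (k - 1) / 2 - 1) * (x / k * (x / k))
      = x * headMass (1 / k) x := by
    unfold headMass; field_simp; ring
  have hA0 : 0 ≤ x * headMass (1 / k) x := by
    refine mul_nonneg hx0.le (add_nonneg ?_ (mul_nonneg hx0.le ?_))
    · exact mul_nonneg (by linarith) hs0.le
    · nlinarith
  set c : ℝ := 2 * x * (1 - x) / k with hc
  set d : ℝ := (x / k) ^ 2 with hd
  have hc0 : 0 ≤ c := by
    rw [hc]; exact div_nonneg (mul_nonneg (by linarith) (by linarith)) hk0.le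
  have hB (j : ℕ) : x / k + x / k - (2 * (k : ℝ) - j + 1) * (x / k * (x / k))
      = c + ((j : ℝ) - 1) * d := by
    rw [hc, hd]; field_simp; ring
  have hn : ((k - 1 : ℕ) : ℝ) = k - 1 := by push_cast [Nat.cast_sub (by omega : 1 ≤ k)]; ring
  have hr' : 0 < x / (k * r) := by positivity
  have hsum : x * (tailMass (1 / k) x * (1 - Real.log x + Real.log k + Real.log r)
        - tailSq (1 / k) x * r)
      ≤ ∑ j ∈ Finset.Icc 1 (k - 1),
        -((c + ((j : ℝ) - 1) * d) * Real.log (c + ((j : ℝ) - 1) * d)) := by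
    calc _ = ∑ j ∈ Finset.Icc 1 (k - 1), ((c + ((j : ℝ) - 1) * d) *
          (1 - Real.log (x / (k * r))) - (c + ((j : ℝ) - 1) * d) ^ 2 / (x / (k * r))) := by
          rw [Finset.sum_sub_distrib, ← Finset.sum_mul, ← Finset.sum_div, sum_affine,
            sum_affine_sq, hn, Real.log_div hx0.ne' (by positivity),
            Real.log_mul hk0.ne' hr.ne', hc, hd]
          unfold tailMass tailSq headMass
          field_simp
          ring
      _ ≤ _ := by
          refine Finset.sum_le_sum fun j hj => neg_mul_log_ge ?_ hr'
          have : (1 : ℝ) ≤ j := by exact_mod_cast (Finset.mem_Icc.1 hj).1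
          exact add_nonneg hc0 (mul_nonneg (by linarith) (sq_nonneg _))
  have hhead := neg_mul_log_ge hA0 (mul_pos hx0 ht)
  rw [Real.log_mul hx0.ne' ht.ne'] at hhead
  have hsq : (x * headMass (1 / k) x) ^ 2 / (x * t) = x * (headMass (1 / k) x ^ 2 / t) := by
    field_simp
  have hkx : (k : ℝ) * (x / k) = x := by field_simp
  have hlog : Real.log ((1 - x) * (1 - x)) = 2 * Real.log (1 - x) := by
    rw [← sq, Real.log_pow]; norm_num
  simp only [g, hB, hA, hkx, hlog]
  rw [Finset.sum_neg_distrib] at hsum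
  rw [hsq] at hhead
  linear_combination hsum + hhead

theorem h_div {k : ℕ} (hk : 1 ≤ k) (m : ℕ) {x : ℝ} (hx0 : 0 < x) :
    h k m (x / k) = -(x * Real.log x) - (1 - x) * Real.log (1 - x) + x * Real.log k
      + (1 - x) * Real.log m := by
  have hk0 : (0 : ℝ) < k := by exact_mod_cast (by omega : 0 < k)
  have hkx : (k : ℝ) * (x / k) = x := by field_simp
  rw [h, hkx, Real.log_div hx0.ne' hk0.ne']
  ring

/-! ### Numerical logarithm estimates and signs of the masses. -/

theorem inv_mul_log_le {k : ℕ} (hk : 1 ≤ k) :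
    1 / (k : ℝ) * Real.log k ≤ 0.792 * (1 / k) + 1 / 6 := by
  have hk0 : (0 : ℝ) < k := by exact_mod_cast (by omega : 0 < k)
  have h6 : Real.log 6 = Real.log 2 + Real.log 3 := by
    rw [← Real.log_mul (by norm_num) (by norm_num)]; norm_num
  -- Tangent at `6`, with `log 6 - 1 < 0.792`.
  have h1 : Real.log k ≤ 0.792 + k / 6 := by
    linarith [log_le_tangent hk0 (show (0 : ℝ) < 6 by norm_num), Real.log_two_lt_d9,
      Real.log_three_lt_d9]
  calc 1 / (k : ℝ) * Real.log k ≤ 1 / k * (0.792 + k / 6) :=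
        mul_le_mul_of_nonneg_left h1 (by positivity)
    _ = _ := by field_simp

theorem log_five_fourths_ge : (1 : ℝ) / 5 ≤ Real.log 5 - 2 * Real.log 2 := by
  have h := log_le_tangent (show (0 : ℝ) < 4 by norm_num) (show (0 : ℝ) < 5 by norm_num)
  have h4 : Real.log 4 = 2 * Real.log 2 := by
    rw [show (4 : ℝ) = 2 ^ 2 by norm_num, Real.log_pow]; norm_num
  linarith

theorem log_gt_of_five_le {k : ℕ} (hk : 5 ≤ k) : 1.5 < Real.log k := by
  have : Real.log 5 ≤ Real.log k := Real.log_le_log (by norm_num) (by exact_mod_cast hk)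
  linarith [log_five_fourths_ge, Real.log_two_gt_d9]

/-- For `k ≥ 6` the choice `e = 0` works. For `k = 5`, integrality forces `m ≤ 2 < √5`, which frees
the slack `e = 1 / 10 = 3 / 5 - 1 / 2`. -/
theorem exists_log_le {k m : ℕ} (hk : 5 ≤ k) (hm : 1 ≤ m) (hmk : (m : ℝ) ≤ Real.sqrt k) :
    ∃ e : ℝ, 0 ≤ e ∧ 3 * (1 / (k : ℝ)) - 1 / 2 ≤ e ∧ Real.log m + e ≤ Real.log k / 2 := by
  have hm0 : (0 : ℝ) < m := by exact_mod_cast hm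
  rcases hk.eq_or_lt with rfl | hk
  · have hm2 : m ≤ 2 := by
      have h1 : (m : ℝ) ^ 2 ≤ (5 : ℕ) := (Real.le_sqrt hm0.le (by positivity)).1 hmk
      have h2 : m ^ 2 ≤ 5 := by exact_mod_cast h1
      nlinarith
    have : Real.log m ≤ Real.log 2 := Real.log_le_log hm0 (by exact_mod_cast hm2)
    refine ⟨1 / 10, by norm_num, by norm_num, ?_⟩
    push_cast
    linarith [log_five_fourths_ge]
  · refine ⟨0, le_rfl, ?_, ?_⟩
    · have : (1 : ℝ) / k ≤ 1 / 6 :=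
        one_div_le_one_div_of_le (by norm_num) (by exact_mod_cast hk)
      linarith
    · rw [add_zero, ← Real.log_sqrt (Nat.cast_nonneg k)]
      exact Real.log_le_log hm0 hmk

theorem headMass_nonneg {s x : ℝ} (hs0 : 0 ≤ s) (hs : s ≤ 1) (hx0 : 0 ≤ x) (hx1 : x ≤ 1) :
    0 ≤ headMass s x := by
  refine add_nonneg (mul_nonneg (by linarith) hs0) (mul_nonneg hx0 ?_)
  nlinarith

theorem tailMass_nonneg {s x : ℝ} (hs : s ≤ 1 / 5) (hx0 : 0 ≤ x) (hx1 : x ≤ 1) :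
    0 ≤ tailMass s x := by
  have h : tailMass s x = (1 - s) * (2 * (1 - x) + x * (1 - 2 * s) / 2) := by
    unfold tailMass headMass; ring
  rw [h]
  exact mul_nonneg (by linarith) (add_nonneg (by linarith)
    (div_nonneg (mul_nonneg hx0 (by linarith)) (by norm_num)))

theorem logCoeff_nonneg {s x : ℝ} (hs0 : 0 ≤ s) (hs : s ≤ 1 / 5) (hx1 : x ≤ 1) :
    0 ≤ logCoeff s x := by
  unfold logCoeff
  nlinarith

/-! ### The affine expression at the extreme weights. -/

theorem h_div_sub_log_pos {k m : ℕ} (hk : 5 ≤ k) {e : ℝ} (he : 0 ≤ e)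
    (hL : Real.log m + e ≤ Real.log k / 2) {x : ℝ} (hx0 : 0 < x) (hx1 : x ≤ 1) :
    0 < h k m (x / k) - Real.log m := by
  rw [h_div (by omega) m hx0]
  have h1 : 0 ≤ -(x * Real.log x) := by
    have := Real.log_nonpos hx0.le hx1
    nlinarith
  have h2 : 0 ≤ -((1 - x) * Real.log (1 - x)) := by
    have := Real.log_nonpos (show 0 ≤ 1 - x by linarith) (by linarith)
    nlinarith
  have h3 : 0 < x * (Real.log k - Real.log m) :=
    mul_pos hx0 (by linarith [log_gt_of_five_le hk])
  linarith

/-- The bound at total weight `1 / (2 * x)`, from tangents at `t` and `r`. -/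
theorem half_weight_bound {k m : ℕ} (hk : 5 ≤ k) {e : ℝ}
    (hL : Real.log m + e ≤ Real.log k / 2) {x t r : ℝ} (hx0 : 0 < x) (hx1 : x ≤ 1)
    (ht : 0 < t) (hr : 0 < r)
    (hp : 0 ≤ -Real.log x * x
      + (headMass (1 / k) x * (1 - Real.log t) - headMass (1 / k) x ^ 2 / t)
      + (tailMass (1 / k) x * (1 + Real.log r) - tailSq (1 / k) x * r)
      - logCoeff (1 / k) x * (0.792 * (1 / k) + 1 / 6) + e * x) :
    0 ≤ 2 * x * (h k m (x / k) - Real.log m)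
      + (g k m (x / k) (x / k) - 2 * h k m (x / k) + Real.log m) := by
  have hs : (1 : ℝ) / k ≤ 1 / 5 := one_div_le_one_div_of_le (by norm_num) (by exact_mod_cast hk)
  have hs0 : (0 : ℝ) ≤ 1 / k := by positivity
  have hg := g_diag_ge (k := k) (by omega) m hx0 hx1 ht hr
  have hl := mul_le_mul_of_nonneg_left (inv_mul_log_le (k := k) (by omega))
    (logCoeff_nonneg hs0 hs hx1)
  have hL' := mul_le_mul_of_nonneg_left hL hx0.le
  have hq : 0 ≤ x * (-Real.log x * x
      + (headMass (1 / k) x * (1 - Real.log t) - headMass (1 / k) x ^ 2 / t)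
      + (tailMass (1 / k) x * (1 + Real.log r) - tailSq (1 / k) x * r)
      - logCoeff (1 / k) x * (1 / k * Real.log k) + x * (Real.log k / 2 - Real.log m)) :=
    mul_nonneg hx0.le (by linarith)
  rw [h_div (by omega) m hx0]
  have hT : tailMass (1 / k) x = 2 - x - headMass (1 / k) x := rfl
  -- Once `log m` is replaced by `log k / 2`, `log k` has coefficient `x * (x / 2 - headMass (1 / k)
  -- x)`; the `log (1 - x)` terms cancel at this weight.
  have hc : logCoeff (1 / k) x * (1 / k) = headMass (1 / k) x - x / 2 := by
    unfold logCoeff headMass; ring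
  rw [hT] at hg hq
  linear_combination hg + hq - x * Real.log k * hc

/-- The bound at total weight `1`, from tangents at `t` and `r`. -/
theorem full_weight_bound {k m : ℕ} (hk : 5 ≤ k) {e : ℝ}
    (hL : Real.log m + e ≤ Real.log k / 2) {x t r : ℝ} (hx0 : 0 < x) (hx1 : x < 1 / 2)
    (ht : 0 < t) (hr : 0 < r)
    (hp : 0 ≤ (1 - 2 * x) * (1 - x) + -Real.log x * (1 - x)
      + (headMass (1 / k) x * (1 - Real.log t) - headMass (1 / k) x ^ 2 / t)
      + (tailMass (1 / k) x * (1 + Real.log r) - tailSq (1 / k) x * r)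
      - logCoeff (1 / k) x * (0.792 * (1 / k) + 1 / 6) + (1 / 2 - x) * 1.5 + e * (1 - x)) :
    0 < g k m (x / k) (x / k) - h k m (x / k) := by
  have hs : (1 : ℝ) / k ≤ 1 / 5 := one_div_le_one_div_of_le (by norm_num) (by exact_mod_cast hk)
  have hs0 : (0 : ℝ) ≤ 1 / k := by positivity
  have hg := g_diag_ge (k := k) (by omega) m hx0 (by linarith) ht hr
  have hl := mul_le_mul_of_nonneg_left (inv_mul_log_le (k := k) (by omega))
    (logCoeff_nonneg hs0 hs (by linarith : x ≤ 1))
  have hk5 := mul_lt_mul_of_pos_left (log_gt_of_five_le hk) (by linarith : 0 < 1 / 2 - x)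
  have hL' := mul_le_mul_of_nonneg_left hL (by linarith : 0 ≤ 1 - x)
  have hq : 0 < x * ((1 - 2 * x) * (1 - x) + -Real.log x * (1 - x)
      + (headMass (1 / k) x * (1 - Real.log t) - headMass (1 / k) x ^ 2 / t)
      + (tailMass (1 / k) x * (1 + Real.log r) - tailSq (1 / k) x * r)
      - logCoeff (1 / k) x * (1 / k * Real.log k) + (1 / 2 - x) * Real.log k
      + (1 - x) * (Real.log k / 2 - Real.log m)) :=
    mul_pos hx0 (by linarith)
  -- Here the `log (1 - x)` terms leave `-(1 - 2 * x) * (1 - x) * log (1 - x)`, bounded below using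
  -- `log (1 - x) ≤ -x`.
  have hone : 0 ≤ (1 - 2 * x) * (1 - x) * (-x - Real.log (1 - x)) :=
    mul_nonneg (mul_nonneg (by linarith) (by linarith))
      (by linarith [Real.log_le_sub_one_of_pos (show 0 < 1 - x by linarith)])
  rw [h_div (by omega) m hx0]
  have hT : tailMass (1 / k) x = 2 - x - headMass (1 / k) x := rfl
  have hc : logCoeff (1 / k) x * (1 / k) = headMass (1 / k) x - x / 2 := by
    unfold logCoeff headMass; ring
  rw [hT] at hg hq
  linear_combination hg + hq + hone - x * Real.log k * hc

theorem log_half_le : 1.693 ≤ 1 - Real.log (1 / 2) := by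
  rw [one_div, Real.log_inv]
  linarith [Real.log_two_gt_d9]

theorem log_27_32_ge : 0.83 ≤ 1 + Real.log (27 / 32) := by
  rw [Real.log_div (by norm_num) (by norm_num), show (27 : ℝ) = 3 ^ 3 by norm_num,
    show (32 : ℝ) = 2 ^ 5 by norm_num, Real.log_pow, Real.log_pow]
  push_cast
  linarith [Real.log_two_lt_d9, Real.log_three_gt_d9]

theorem log_three_fourths_le : 1.2876 ≤ 1 - Real.log (3 / 4) := by
  rw [Real.log_div (by norm_num) (by norm_num), show (4 : ℝ) = 2 ^ 2 by norm_num, Real.log_pow]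
  push_cast
  linarith [Real.log_two_gt_d9, Real.log_three_lt_d9]

theorem neg_log_ge {x : ℝ} (hx0 : 0 < x) : 1.693 - 2 * x ≤ -Real.log x := by
  linarith [log_le_tangent hx0 (show (0 : ℝ) < 1 / 2 by norm_num), log_half_le]

theorem half_weight_nonneg {k m : ℕ} (hk : 5 ≤ k) (hm : 1 ≤ m) (hmk : (m : ℝ) ≤ Real.sqrt k)
    {x : ℝ} (hx : 1 / 2 ≤ x) (hx1 : x ≤ 1) :
    0 ≤ 2 * x * (h k m (x / k) - Real.log m)
      + (g k m (x / k) (x / k) - 2 * h k m (x / k) + Real.log m) := by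
  obtain ⟨e, he0, he, hL⟩ := exists_log_le hk hm hmk
  have hs : (1 : ℝ) / k ≤ 1 / 5 := one_div_le_one_div_of_le (by norm_num) (by exact_mod_cast hk)
  have hs0 : (0 : ℝ) ≤ 1 / k := by positivity
  have hx0 : 0 < x := by linarith
  have hH := headMass_nonneg hs0 (by linarith) hx0.le hx1
  have hT := tailMass_nonneg hs hx0.le hx1
  rcases le_total x (3 / 4) with h | h
  · refine half_weight_bound hk hL (t := 1 / 2) (r := 27 / 32) hx0 hx1
      (by norm_num) (by norm_num) ?_
    linarith [poly_nonneg_mid hs0 hs he0 he hx h, mul_le_mul_of_nonneg_left log_half_le hH,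
      mul_le_mul_of_nonneg_left log_27_32_ge hT, mul_le_mul_of_nonneg_right (neg_log_ge hx0) hx0.le]
  · refine half_weight_bound hk hL (t := 3 / 4) (r := 2) hx0 hx1
      (by norm_num) (by norm_num) ?_
    have h2 : 1.693 ≤ 1 + Real.log 2 := by linarith [Real.log_two_gt_d9]
    have hlog : 1 - x ≤ -Real.log x := by linarith [Real.log_le_sub_one_of_pos hx0]
    linarith [poly_nonneg_high hs0 hs he0 he h hx1,
      mul_le_mul_of_nonneg_left log_three_fourths_le hH,
      mul_le_mul_of_nonneg_left h2 hT, mul_le_mul_of_nonneg_right hlog hx0.le]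

theorem full_weight_pos {k m : ℕ} (hk : 5 ≤ k) (hm : 1 ≤ m) (hmk : (m : ℝ) ≤ Real.sqrt k)
    {x : ℝ} (hx0 : 0 < x) (hx : x < 1 / 2) :
    0 < g k m (x / k) (x / k) - h k m (x / k) := by
  obtain ⟨e, he0, he, hL⟩ := exists_log_le hk hm hmk
  have hs : (1 : ℝ) / k ≤ 1 / 5 := one_div_le_one_div_of_le (by norm_num) (by exact_mod_cast hk)
  have hs0 : (0 : ℝ) ≤ 1 / k := by positivity
  have hx1 : x ≤ 1 := by linarith
  have hH := headMass_nonneg hs0 (by linarith) hx0.le hx1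
  have hT := tailMass_nonneg hs hx0.le hx1
  refine full_weight_bound hk hL (t := 1 / 2) (r := 27 / 32) hx0 hx
    (by norm_num) (by norm_num) ?_
  linarith [poly_nonneg_low hs0 hs he0 he hx0.le hx.le, mul_le_mul_of_nonneg_left log_half_le hH,
    mul_le_mul_of_nonneg_left log_27_32_ge hT,
    mul_le_mul_of_nonneg_right (neg_log_ge hx0) (by linarith : 0 ≤ 1 - x)]

end Frankl

theorem mainTheorem10 (k m : ℕ) (hk : 5 ≤ k) (hm : 1 ≤ m) (hmk : (m : ℝ) ≤ Real.sqrt k)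
    (φ : ℝ) (hφ0 : 0 < φ) (hφ : φ < 1 / 2) (x : ℝ) (hx : x ∈ Set.Icc φ 1) :
    Frankl.typeII φ x ∈ Frankl.M φ ∧ 0 < Frankl.F k m (Frankl.typeII φ x) := by
  refine ⟨Frankl.typeII_mem_M hφ0 hx, ?_⟩
  have hx0 : 0 < x := hφ0.trans_le hx.1
  obtain ⟨e, he0, -, hL⟩ := Frankl.exists_log_le hk hm hmk
  have hH := Frankl.h_div_sub_log_pos hk he0 hL hx0 hx.2
  have hw : 0 < φ / x := by positivity
  rw [Frankl.F_typeII (by omega) m hφ0 hx]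
  refine mul_pos hw ?_
  rcases lt_or_ge x (1 / 2) with h | h
  · have hG := Frankl.full_weight_pos hk hm hmk hx0 h
    have hw1 : φ / x ≤ 1 := (div_le_one hx0).2 hx.1
    linarith [mul_pos hw hG, mul_nonneg (sub_nonneg.2 hw1) hH.le]
  · have hG := mul_nonneg hw.le (Frankl.half_weight_nonneg hk hm hmk h hx.2)
    -- The end value times `w` contributes `2 * φ` copies of `h - log m`; the remaining `1 - 2 * φ >
    -- 0` copies make the inequality strict.
    have hwx : φ / x * x = φ := div_mul_cancel₀ φ hx0.ne'
    have h2 := mul_pos (show 0 < 1 - 2 * φ by linarith) hH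
    linear_combination h2 + hG + 2 * (Frankl.h k m (x / k) - Real.log m) * hwx
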